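/- Let $A\in\mathbb{R}^{n\times n}$, $B\in\mathbb{R}^{n\times m}$, $C\in\mathbb{R}^{p\times n}$, $D\in\mathbb{R}^{p\times m}$, $K\in\mathbb{R}^{r\times n}$, and consider the system $$\dot x(t)=Ax(t)+Bu(t),\qquad y(t)=Cx(t)+Du(t),\qquad z(t)=Kx(t),\qquad t\in\mathbb{R}.$$ A solution is a quadruple $(x,u,y,z)$ of locally integrable functions on $\mathbb{R}$ with values in $\mathbb{R}^n,\mathbb{R}^m,\mathbb{R}^p,\mathbb{R}^r$ such that $x$ is locally absolutely continuous and the three equations hold for almost every $t$. The pair $(A,C)$ is called partially detectable with respect to $K$ if for all solutions $(x_1,u,y,z_1)$ and $(x_2,u,y,z_2)$ with the same input and output one has $z_1(t)-z_2(t)\to0$ as $t\to\infty$, where $w(t)\to 0$ means $\lim_{t\to\infty}\operatorname{ess\,sup}_{s\ge t}\|w(s)\|=0$ (equivalently: every solution $(x,0,0,z)$ satisfies $z(t)\to0$). For $\lambda\in\mathbb{C}$ let $$\mathcal{D}_{[A,C],n,\lambda}=\begin{bmatrix} C\\ C(\lambda I_n-A)\\ \vdots\\ C(\lambda I_n-A)^{n-1}\\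 (\lambda I_n-A)^n\end{bmatrix}.$$ Fix an orthogonal matrix $P\in\mathbb{R}^{n\times n}$ and $n_1+n_2+n_3=n$ such that $$P^\top AP=\begin{bmatrix}A_{o_1}&0&0\\A_{21}&A_{\bar o_2}&0\\A_{31}&A_{32}&A_{\bar o_3}\end{bmatrix},\quad P^\top B=\begin{bmatrix}B_{o_1}\\B_{\bar o_2}\\B_{\bar o_3}\end{bmatrix},\quad CP=\begin{bmatrix}C_{o_1}&0&0\end{bmatrix},\quad KP=\begin{bmatrix}K_{o_1}&K_{\bar o_2}&K_{\bar o_3}\end{bmatrix},$$ with blocks of sizes $n_1,n_2,n_3$, where the pair $(A_{o_1},C_{o_1})$ is observable (its observability matrix has rank $n_1$), all complex eigenvalues of $A_{\bar o_2}$ have negative real part, and all complex eigenvalues of $A_{\bar o_3}$ have nonnegative real part. **Theorem.** The following statements are equivalent: 1. $(A,C)$ is partially detectable with respect to $K$. 2. For every $\lambda\in\mathbb{C}$ with $\operatorname{Re}\lambda\ge0$, $$\operatorname{rank}\begin{bmatrix}\mathcal{D}_{[A,C],n,\lambda}\\K\end{bmatrix}=\operatorname{rank}\mathcal{D}_{[A,C],n,\lambda}.$$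 3. $K_{\bar o_3}=0$. -/

import Mathlib

open MeasureTheory Filter Topology

noncomputable section

namespace PartialDetect

/-- The quadruple `(x, u, y, z)` is a solution on `ℝ` of the state-space system
`x' = A x + B u`, `y = C x + D u`, `z = K x`: all four components are locally integrable, `x` is
absolutely continuous on every compact interval, and the three equations hold for almost
every time. -/
structure IsSolution {n m p r : ℕ}
    (A : Matrix (Fin n) (Fin n) ℝ) (B : Matrix (Fin n) (Fin m) ℝ)
    (C : Matrix (Fin p) (Fin n) ℝ) (D : Matrix (Fin p) (Fin m) ℝ)
    (K : Matrix (Fin r) (Fin n) ℝ)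
    (x : ℝ → Fin n → ℝ) (u : ℝ → Fin m → ℝ) (y : ℝ → Fin p → ℝ) (z : ℝ → Fin r → ℝ) :
    Prop where
  locallyIntegrable_x : LocallyIntegrable x
  locallyIntegrable_u : LocallyIntegrable u
  locallyIntegrable_y : LocallyIntegrable y
  locallyIntegrable_z : LocallyIntegrable z
  absolutelyContinuous : ∀ a b : ℝ, AbsolutelyContinuousOnInterval x a b
  state_eq : ∀ᵐ t : ℝ, HasDerivAt x (A.mulVec (x t) + B.mulVec (u t)) t
  output_eq : ∀ᵐ t : ℝ, y t = C.mulVec (x t) + D.mulVec (u t)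
  functional_eq : ∀ᵐ t : ℝ, z t = K.mulVec (x t)

/-- `z(t) → 0` as `t → ∞`, meaning `lim_{t → ∞} ess sup_{s ≥ t} ‖z(s)‖ = 0` for the
Euclidean norm (the essential supremum is taken in `[0, ∞]`). -/
def EssTendstoZero {r : ℕ} (z : ℝ → Fin r → ℝ) : Prop :=
  Tendsto
    (fun t : ℝ => essSup (fun s : ℝ => ‖WithLp.toLp 2 (z s)‖ₑ) (volume.restrict (Set.Ici t)))
    atTop (𝓝 0)

/-- Partial detectability with respect to `K`: any two solutions with the same input and the
same output have functionals `z₁`, `z₂` with `z₁(t) - z₂(t) → 0`. -/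
def PartiallyDetectable {n m p r : ℕ}
    (A : Matrix (Fin n) (Fin n) ℝ) (B : Matrix (Fin n) (Fin m) ℝ)
    (C : Matrix (Fin p) (Fin n) ℝ) (D : Matrix (Fin p) (Fin m) ℝ)
    (K : Matrix (Fin r) (Fin n) ℝ) : Prop :=
  ∀ (x₁ x₂ : ℝ → Fin n → ℝ) (u : ℝ → Fin m → ℝ) (y : ℝ → Fin p → ℝ) (z₁ z₂ : ℝ → Fin r → ℝ),
    IsSolution A B C D K x₁ u y z₁ → IsSolution A B C D K x₂ u y z₂ →
      EssTendstoZero (fun t => z₁ t - z₂ t)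

/-- The observability matrix with block rows `C, C A, …, C A ^ (n - 1)`. -/
def obsMatrix {n p : ℕ} (A : Matrix (Fin n) (Fin n) ℝ) (C : Matrix (Fin p) (Fin n) ℝ) :
    Matrix (Fin n × Fin p) (Fin n) ℝ :=
  Matrix.of fun i j => (C * A ^ (i.1 : ℕ)) i.2 j

/-- Observability of the pair `(A, C)`: the observability matrix has full column rank. -/
def Observable {n p : ℕ} (A : Matrix (Fin n) (Fin n) ℝ) (C : Matrix (Fin p) (Fin n) ℝ) : Prop :=
  (obsMatrix A C).rank = n

/-- The spectrum (the set of complex eigenvalues) of a real square matrix. -/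
def complexSpectrum {n : ℕ} (A : Matrix (Fin n) (Fin n) ℝ) : Set ℂ :=
  spectrum ℂ (A.map Complex.ofReal)

/-- The matrix `𝒟_{[A,C],k,μ}` with block rows
`C, C (μ I - A), …, C (μ I - A) ^ (k - 1), (μ I - A) ^ k`. -/
def detMatrix {n p : ℕ} (A : Matrix (Fin n) (Fin n) ℝ) (C : Matrix (Fin p) (Fin n) ℝ)
    (k : ℕ) (μ : ℂ) : Matrix ((Fin k × Fin p) ⊕ Fin n) (Fin n) ℂ :=
  Matrix.fromRows
    (Matrix.of fun (i : Fin k × Fin p) (j : Fin n) =>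
      (C.map Complex.ofReal * (μ • (1 : Matrix (Fin n) (Fin n) ℂ) - A.map Complex.ofReal) ^
        (i.1 : ℕ)) i.2 j)
    ((μ • (1 : Matrix (Fin n) (Fin n) ℂ) - A.map Complex.ofReal) ^ k)

/-- The order-preserving identification of three consecutive blocks of indices, of sizes
`n₁`, `n₂`, `n₃`, with `{0, …, n - 1}`, where `n = n₁ + n₂ + n₃`. -/
def blockEquiv {n n₁ n₂ n₃ : ℕ} (h : n₁ + n₂ + n₃ = n) :
    (Fin n₁ ⊕ Fin n₂) ⊕ Fin n₃ ≃ Fin n :=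
  ((Equiv.sumCongr finSumFinEquiv (Equiv.refl (Fin n₃))).trans finSumFinEquiv).trans
    (finCongr h)

/-- A decomposition of `(A, B, C, K)` by an orthogonal matrix `P` into an observable part
(index 1), an unobservable stable part (index 2) and an unobservable unstable part (index 3).
Equations are between block matrices, the index set `Fin n` being split by `blockEquiv`. -/
structure Decomposition {n m p r : ℕ}
    (A : Matrix (Fin n) (Fin n) ℝ) (B : Matrix (Fin n) (Fin m) ℝ)
    (C : Matrix (Fin p) (Fin n) ℝ) (K : Matrix (Fin r) (Fin n) ℝ)
    (P : Matrix (Fin n) (Fin n) ℝ) (n₁ n₂ n₃ : ℕ) where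
  orthogonal : P ∈ Matrix.orthogonalGroup (Fin n) ℝ
  dim_eq : n₁ + n₂ + n₃ = n
  A₁ : Matrix (Fin n₁) (Fin n₁) ℝ
  A₂₁ : Matrix (Fin n₂) (Fin n₁) ℝ
  A₂ : Matrix (Fin n₂) (Fin n₂) ℝ
  A₃₁ : Matrix (Fin n₃) (Fin n₁) ℝ
  A₃₂ : Matrix (Fin n₃) (Fin n₂) ℝ
  A₃ : Matrix (Fin n₃) (Fin n₃) ℝ
  B₁ : Matrix (Fin n₁) (Fin m) ℝ
  B₂ : Matrix (Fin n₂) (Fin m) ℝ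
  B₃ : Matrix (Fin n₃) (Fin m) ℝ
  C₁ : Matrix (Fin p) (Fin n₁) ℝ
  K₁ : Matrix (Fin r) (Fin n₁) ℝ
  K₂ : Matrix (Fin r) (Fin n₂) ℝ
  K₃ : Matrix (Fin r) (Fin n₃) ℝ
  A_eq : (P.transpose * A * P).submatrix (blockEquiv dim_eq) (blockEquiv dim_eq) =
    Matrix.fromBlocks (Matrix.fromBlocks A₁ 0 A₂₁ A₂) 0 (Matrix.fromCols A₃₁ A₃₂) A₃
  B_eq : (P.transpose * B).submatrix (blockEquiv dim_eq) id =
    Matrix.fromRows (Matrix.fromRows B₁ B₂) B₃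
  C_eq : (C * P).submatrix id (blockEquiv dim_eq) =
    Matrix.fromCols (Matrix.fromCols C₁ 0) 0
  K_eq : (K * P).submatrix id (blockEquiv dim_eq) =
    Matrix.fromCols (Matrix.fromCols K₁ K₂) K₃
  observable : Observable A₁ C₁
  stable : ∀ μ ∈ complexSpectrum A₂, μ.re < 0
  unstable : ∀ μ ∈ complexSpectrum A₃, 0 ≤ μ.re

end PartialDetect

end

/-! Statements 1 and 2 are each shown equivalent to `K₃ = 0`.

The difference `x` of two solutions with equal input and output satisfies `x' = A x` and `C x = 0`.
Observability forces its first block to vanish, so its second block solves `w' = A₂ w` and decays.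
If `K₃ = 0`, the functional sees only these two blocks and tends to zero. Conversely, the last block
column `E₃` of `P` spans an `A`-invariant subspace of `ker C` on which `A` acts as `A₃`, so every
solution of `w' = A₃ w` yields a solution with zero input and output and functional `K₃ w`. On
generalized eigenvectors, by induction on their order, `K₃ w(t) = exp(tμ) K₃ v`. Since `0 ≤ Re μ`,
this tends to zero only if `K₃ v = 0`, and such `v` span.

By rank-nullity, statement 2 says that the kernel of `detMatrix` lies in that of `K`. This kernel is
the generalized eigenspace of `A` at `μ` intersected with the unobservable subspace. For `0 ≤ Re μ`
its vectors have zero first and second blocks, and it contains the image under `E₃` of the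
generalized eigenspace of `A₃`. -/

namespace PartialDetect

/-! ### Solutions built from generalized eigenvectors -/

/-- The solution of `x' = M x` with initial value a generalized eigenvector `v` for `μ`, of
order at most `N`. -/
noncomputable def genSolution {n : ℕ} (M : Matrix (Fin n) (Fin n) ℂ) (μ : ℂ) (N : ℕ)
    (v : Fin n → ℂ) (t : ℝ) : Fin n → ℂ :=
  Complex.exp (t * μ) • ∑ j ∈ Finset.range N,
    ((t : ℂ) ^ j / (j.factorial : ℂ)) • ((M - μ • 1) ^ j).mulVec v

lemma hasDerivAt_pow_div_factorial (j : ℕ) (t : ℝ) :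
    HasDerivAt (fun s : ℝ => (s : ℂ) ^ (j + 1) / ((j + 1).factorial : ℂ))
      ((t : ℂ) ^ j / (j.factorial : ℂ)) t := by
  have h := ((hasDerivAt_pow (j + 1) (t : ℂ)).comp_ofReal).div_const ((j + 1).factorial : ℂ)
  refine h.congr_deriv ?_
  have h1 : ((j : ℂ) + 1) ≠ 0 := by exact_mod_cast Nat.succ_ne_zero j
  have h2 : (j.factorial : ℂ) ≠ 0 := by exact_mod_cast j.factorial_ne_zero
  rw [Nat.factorial_succ]
  push_cast
  field_simp

/-- With `Q = M - μ`, the exponential `exp(tM) v` factors as `exp(tμ) exp(tQ) v`, and the series of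
`exp(tQ) v` stops because `Q ^ N` kills `v`. -/
lemma hasDerivAt_genSolution {n : ℕ} (M : Matrix (Fin n) (Fin n) ℂ) (μ : ℂ) (N : ℕ)
    (v : Fin n → ℂ) (hv : ((M - μ • 1) ^ N).mulVec v = 0) (t : ℝ) :
    HasDerivAt (genSolution M μ N v) (M.mulVec (genSolution M μ N v t)) t := by
  set Q := M - μ • (1 : Matrix (Fin n) (Fin n) ℂ) with hQ
  have hM : M = Q + μ • 1 := by simp [hQ]
  have he : HasDerivAt (fun s : ℝ => Complex.exp (s * μ)) (Complex.exp (t * μ) * μ) t := by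
    have := (((hasDerivAt_id (t : ℂ)).mul_const μ).cexp).comp_ofReal
    simpa using this
  have hs : HasDerivAt (fun s : ℝ => ∑ j ∈ Finset.range N,
      ((s : ℂ) ^ j / (j.factorial : ℂ)) • (Q ^ j).mulVec v)
      (Q.mulVec (∑ j ∈ Finset.range N, ((t : ℂ) ^ j / (j.factorial : ℂ)) • (Q ^ j).mulVec v)) t := by
    rcases N with _ | N
    · simpa using hasDerivAt_const t (0 : Fin n → ℂ)
    · have h1 : Q.mulVec (∑ j ∈ Finset.range (N + 1),
          ((t : ℂ) ^ j / (j.factorial : ℂ)) • (Q ^ j).mulVec v) =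
          ∑ j ∈ Finset.range N, ((t : ℂ) ^ j / (j.factorial : ℂ)) • (Q ^ (j + 1)).mulVec v := by
        rw [Matrix.mulVec_sum, Finset.sum_range_succ]
        simp only [Matrix.mulVec_smul, Matrix.mulVec_mulVec, ← pow_succ']
        rw [hv, smul_zero, add_zero]
      rw [h1]
      simp only [Finset.sum_range_succ']
      have h2 := HasDerivAt.fun_sum (u := Finset.range N) fun j _ =>
        (hasDerivAt_pow_div_factorial j t).smul_const ((Q ^ (j + 1)).mulVec v)
      simpa using h2.add_const v
  refine (he.fun_smul hs).congr_deriv ?_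
  change _ = M.mulVec (Complex.exp (t * μ) • ∑ j ∈ Finset.range N,
    ((t : ℂ) ^ j / (j.factorial : ℂ)) • (Q ^ j).mulVec v)
  rw [hM, Matrix.add_mulVec, Matrix.smul_mulVec, Matrix.one_mulVec,
    Matrix.mulVec_smul, smul_smul, mul_comm μ]

/-- The order `N + 1` rules out the empty sum, which would vanish at time zero. -/
lemma genSolution_zero {n : ℕ} (M : Matrix (Fin n) (Fin n) ℂ) (μ : ℂ) (N : ℕ)
    (v : Fin n → ℂ) : genSolution M μ (N + 1) v 0 = v := by
  simp [genSolution, Finset.sum_range_succ']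

lemma tendsto_genSolution {n : ℕ} (M : Matrix (Fin n) (Fin n) ℂ) {μ : ℂ} (hμ : μ.re < 0) (N : ℕ)
    (v : Fin n → ℂ) : Tendsto (genSolution M μ N v) atTop (𝓝 0) := by
  have key : ∀ j : ℕ, Tendsto
      (fun t : ℝ => Complex.exp (t * μ) * ((t : ℂ) ^ j / (j.factorial : ℂ))) atTop (𝓝 0) := by
    intro j
    rw [tendsto_zero_iff_norm_tendsto_zero]
    have h := (Real.tendsto_pow_mul_exp_neg_atTop_nhds_zero j).comp
      (tendsto_id.const_mul_atTop (neg_pos.mpr hμ))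
    -- The limit `s ^ j * exp (-s) → 0` is used at `s = -Re μ * t`; this constant removes the factor
    -- `(-Re μ) ^ j` and supplies `1 / j!`.
    have h' := (h.mul_const ((-μ.re) ^ j * j.factorial)⁻¹)
    rw [zero_mul] at h'
    refine h'.congr' ?_
    filter_upwards [eventually_ge_atTop (0 : ℝ)] with t ht
    have h1 : (-μ.re) ^ j ≠ 0 := pow_ne_zero _ (by linarith)
    have h2 : (j.factorial : ℝ) ≠ 0 := by exact_mod_cast j.factorial_ne_zero
    simp only [Function.comp, id, norm_mul, norm_div, norm_pow, Complex.norm_real,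
      Complex.norm_exp, Complex.norm_natCast, Real.norm_of_nonneg ht, mul_pow]
    simp only [Complex.mul_re, Complex.ofReal_re, Complex.ofReal_im, zero_mul, sub_zero]
    rw [show -(-μ.re * t) = t * μ.re by ring]
    field_simp
  unfold genSolution
  simp only [Finset.smul_sum, smul_smul]
  rw [show (0 : Fin n → ℂ) = ∑ j ∈ Finset.range N, (0 : ℂ) • ((M - μ • 1) ^ j).mulVec v by simp]
  exact tendsto_finsetSum _ fun j _ => (key j).smul_const _

/-! ### Linear differential equations with a stable matrix -/

lemma eq_of_hasDerivAt_mulVec {n : ℕ} (M : Matrix (Fin n) (Fin n) ℂ) {f g : ℝ → Fin n → ℂ}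
    (hf : ∀ t, HasDerivAt f (M.mulVec (f t)) t) (hg : ∀ t, HasDerivAt g (M.mulVec (g t)) t)
    (h : f 0 = g 0) : f = g := by
  have hL := (LinearMap.toContinuousLinearMap M.mulVecLin).lipschitz
  exact ODE_solution_unique_univ (v := fun _ x => M.mulVec x) (s := fun _ => Set.univ)
    (fun _ => hL.lipschitzOnWith) (fun t => ⟨hf t, trivial⟩) (fun t => ⟨hg t, trivial⟩) h

lemma mem_maxGenEigenspace_toLin_iff {n : ℕ} (M : Matrix (Fin n) (Fin n) ℂ) (μ : ℂ)
    (v : Fin n → ℂ) :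
    v ∈ Module.End.maxGenEigenspace (Matrix.toLin' M) μ ↔ ((M - μ • 1) ^ n).mulVec v = 0 := by
  have h : (Matrix.toLin' M - μ • (1 : Module.End ℂ (Fin n → ℂ))) = Matrix.toLin' (M - μ • 1) := by
    rw [map_sub, map_smul, Matrix.toLin'_one]; rfl
  rw [Module.End.maxGenEigenspace_eq_genEigenspace_finrank, Module.End.mem_genEigenspace_nat,
    LinearMap.mem_ker, h, ← Matrix.toLin'_pow, Matrix.toLin'_apply]
  simp

/-- Over `ℂ` the generalized eigenspaces span, and exponent `n` exhausts each of them. They are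
already closed under scalars, so additivity of `p` is enough. -/
lemma generalized_eigenvector_induction {n : ℕ} (M : Matrix (Fin n) (Fin n) ℂ)
    {p : (Fin n → ℂ) → Prop}
    (mem : ∀ (μ : ℂ) v, ((M - μ • 1) ^ n).mulVec v = 0 → p v)
    (zero : p 0) (add : ∀ v w, p v → p w → p (v + w)) (v : Fin n → ℂ) : p v := by
  have hv : v ∈ ⨆ μ, Module.End.maxGenEigenspace (Matrix.toLin' M) μ := by
    rw [Module.End.iSup_maxGenEigenspace_eq_top]; trivial
  exact Submodule.iSup_induction _ (motive := p) hv
    (fun μ w hw => mem μ w ((mem_maxGenEigenspace_toLin_iff M μ w).1 hw)) zero add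

/-- The induction above ranges over all `μ`; this disposes of those that are not eigenvalues. -/
lemma eq_zero_of_notMem_spectrum {n : ℕ} {M : Matrix (Fin n) (Fin n) ℂ} {μ : ℂ}
    (h : μ ∉ spectrum ℂ M) {N : ℕ} {v : Fin n → ℂ} (hv : ((M - μ • 1) ^ N).mulVec v = 0) :
    v = 0 := by
  rw [spectrum.notMem_iff, Algebra.algebraMap_eq_smul_one, IsUnit.sub_iff] at h
  have hu := h.pow N
  exact Matrix.mulVec_injective_of_isUnit hu (by rw [hv, Matrix.mulVec_zero])

/-- The initial value is a sum of generalized eigenvectors, each starting a decaying solution; by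
uniqueness `f` is the sum of these solutions. -/
theorem tendsto_zero_of_stable_complex {n : ℕ} (M : Matrix (Fin n) (Fin n) ℂ)
    (hM : ∀ μ ∈ spectrum ℂ M, μ.re < 0) {f : ℝ → Fin n → ℂ}
    (hf : ∀ t, HasDerivAt f (M.mulVec (f t)) t) : Tendsto f atTop (𝓝 0) := by
  obtain ⟨g, hg, h0, hlim⟩ : ∃ g : ℝ → Fin n → ℂ, (∀ t, HasDerivAt g (M.mulVec (g t)) t) ∧
      g 0 = f 0 ∧ Tendsto g atTop (𝓝 0) := by
    refine generalized_eigenvector_induction M (p := fun v => ∃ g : ℝ → Fin n → ℂ,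
      (∀ t, HasDerivAt g (M.mulVec (g t)) t) ∧ g 0 = v ∧ Tendsto g atTop (𝓝 0)) ?_ ?_ ?_ (f 0)
    · intro μ v hv
      by_cases hμ : μ ∈ spectrum ℂ M
      · have hv' : ((M - μ • 1) ^ (n + 1)).mulVec v = 0 := by
          rw [pow_succ', ← Matrix.mulVec_mulVec, hv, Matrix.mulVec_zero]
        exact ⟨_, hasDerivAt_genSolution M μ (n + 1) v hv', genSolution_zero M μ n v,
          tendsto_genSolution M (hM μ hμ) _ _⟩
      · refine ⟨fun _ => 0, fun t => ?_, (eq_zero_of_notMem_spectrum hμ hv).symm,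
          tendsto_const_nhds⟩
        simpa using hasDerivAt_const t (0 : Fin n → ℂ)
    · exact ⟨fun _ => 0, fun t => by simpa using hasDerivAt_const t (0 : Fin n → ℂ), rfl,
        tendsto_const_nhds⟩
    · rintro v w ⟨g, hg, rfl, hg'⟩ ⟨k, hk, rfl, hk'⟩
      refine ⟨g + k, fun t => ?_, rfl, by
        have h := hg'.add hk'
        rwa [add_zero] at h⟩
      rw [Pi.add_apply, Matrix.mulVec_add]
      exact (hg t).add (hk t)
  rwa [eq_of_hasDerivAt_mulVec M hf hg h0.symm]

lemma ofReal_mulVec {m n : ℕ} (M : Matrix (Fin m) (Fin n) ℝ) (v : Fin n → ℝ) :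
    (fun i => ((M.mulVec v i : ℝ) : ℂ)) =
      (M.map Complex.ofReal).mulVec (fun i => (v i : ℂ)) := by
  ext i; simp [Matrix.mulVec, dotProduct]

lemma re_mulVec {m n : ℕ} (M : Matrix (Fin m) (Fin n) ℝ) (v : Fin n → ℂ) :
    (fun i => ((M.map Complex.ofReal).mulVec v i).re) = M.mulVec (fun i => (v i).re) := by
  ext i; simp [Matrix.mulVec, dotProduct]

lemma im_mulVec {m n : ℕ} (M : Matrix (Fin m) (Fin n) ℝ) (v : Fin n → ℂ) :
    (fun i => ((M.map Complex.ofReal).mulVec v i).im) = M.mulVec (fun i => (v i).im) := by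
  ext i; simp [Matrix.mulVec, dotProduct]

theorem tendsto_zero_of_stable {n : ℕ} (M : Matrix (Fin n) (Fin n) ℝ)
    (hM : ∀ μ ∈ complexSpectrum M, μ.re < 0) {f : ℝ → Fin n → ℝ}
    (hf : ∀ t, HasDerivAt f (M.mulVec (f t)) t) : Tendsto f atTop (𝓝 0) := by
  have h := tendsto_zero_of_stable_complex (M.map Complex.ofReal) hM
    (f := fun t i => (f t i : ℂ)) fun t => by
      rw [← ofReal_mulVec]
      exact hasDerivAt_pi.2 fun i => (hasDerivAt_pi.1 (hf t) i).ofReal_comp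
  rw [tendsto_pi_nhds] at h ⊢
  intro i
  exact (Complex.continuous_re.tendsto 0).comp (h i)

/-! ### Observability and kernels -/

lemma eq_zero_of_observable {n p : ℕ} {A : Matrix (Fin n) (Fin n) ℝ} {C : Matrix (Fin p) (Fin n) ℝ}
    (h : Observable A C) {v : Fin n → ℝ} (hv : ∀ i < n, (C * A ^ i).mulVec v = 0) : v = 0 := by
  have h1 := (obsMatrix A C).mulVecLin.finrank_range_add_finrank_ker
  have h2 : Module.finrank ℝ (obsMatrix A C).mulVecLin.range = n := h
  rw [h2, Module.finrank_fin_fun, Nat.add_eq_left, Submodule.finrank_eq_zero] at h1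
  have h3 : v ∈ (obsMatrix A C).mulVecLin.ker := by
    rw [LinearMap.mem_ker, Matrix.mulVecLin_apply]
    ext ⟨i, j⟩
    exact congrFun (hv i i.2) j
  rwa [h1] at h3

/-- Each `C A ^ i` is real, so it annihilates the real and imaginary parts of `v` separately. -/
lemma eq_zero_of_observable_complex {n p : ℕ} {A : Matrix (Fin n) (Fin n) ℝ}
    {C : Matrix (Fin p) (Fin n) ℝ} (h : Observable A C) {v : Fin n → ℂ}
    (hv : ∀ i < n, (C.map Complex.ofReal * (A.map Complex.ofReal) ^ i).mulVec v = 0) : v = 0 := by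
  have hm : ∀ i, C.map Complex.ofReal * (A.map Complex.ofReal) ^ i =
      (C * A ^ i).map Complex.ofReal := by
    intro i
    have h1 : (A ^ i).map Complex.ofReal = (A.map Complex.ofReal) ^ i :=
      Matrix.map_pow A Complex.ofRealHom i
    rw [← h1]
    exact (Matrix.map_mul (f := Complex.ofRealHom)).symm
  simp only [hm] at hv
  have hre := eq_zero_of_observable h (v := fun i => (v i).re) fun i hi => by
    rw [← re_mulVec, hv i hi]; rfl
  have him := eq_zero_of_observable h (v := fun i => (v i).im) fun i hi => by
    rw [← im_mulVec, hv i hi]; rfl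
  ext i
  exact Complex.ext (congrFun hre i) (congrFun him i)

/-- Adding rows can only shrink the kernel, so by rank-nullity equal ranks mean equal kernels. -/
lemma rank_fromRows_eq_iff {m₁ m₂ n : Type*} [Fintype m₁] [Fintype m₂] [Fintype n]
    (M : Matrix m₁ n ℂ) (L : Matrix m₂ n ℂ) :
    (Matrix.fromRows M L).rank = M.rank ↔ ∀ v, M.mulVec v = 0 → L.mulVec v = 0 := by
  have h1 := (Matrix.fromRows M L).mulVecLin.finrank_range_add_finrank_ker
  have h2 := M.mulVecLin.finrank_range_add_finrank_ker
  have hle : (Matrix.fromRows M L).mulVecLin.ker ≤ M.mulVecLin.ker := by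
    intro v hv
    rw [LinearMap.mem_ker, Matrix.mulVecLin_apply, Matrix.fromRows_mulVec] at hv
    rw [LinearMap.mem_ker, Matrix.mulVecLin_apply]
    ext i
    exact congrFun hv (Sum.inl i)
  change Module.finrank ℂ (Matrix.fromRows M L).mulVecLin.range =
    Module.finrank ℂ M.mulVecLin.range ↔ _
  constructor
  · intro h v hv
    have heq := Submodule.eq_of_le_of_finrank_eq hle (by omega)
    have hv' : v ∈ (Matrix.fromRows M L).mulVecLin.ker := heq ▸ hv
    rw [LinearMap.mem_ker, Matrix.mulVecLin_apply, Matrix.fromRows_mulVec] at hv'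
    ext i
    exact congrFun hv' (Sum.inr i)
  · intro h
    have heq : (Matrix.fromRows M L).mulVecLin.ker = M.mulVecLin.ker := by
      refine le_antisymm hle fun v hv => ?_
      have hv' : M.mulVec v = 0 := hv
      rw [LinearMap.mem_ker, Matrix.mulVecLin_apply, Matrix.fromRows_mulVec, hv', h v hv']
      ext (i | i) <;> rfl
    rw [heq] at h1
    omega

/-! ### Solutions of the system -/

lemma absolutelyContinuousOnInterval_of_hasDerivAt {n : ℕ} {x x' : ℝ → Fin n → ℝ}
    (h : ∀ t, HasDerivAt x (x' t) t) (hc : Continuous x') (a b : ℝ) :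
    AbsolutelyContinuousOnInterval x a b := by
  have hd : deriv x = x' := funext fun t => (h t).deriv
  have : ContDiff ℝ 1 x := contDiff_one_iff_deriv.2
    ⟨fun t => (h t).differentiableAt, hd ▸ hc⟩
  exact this.contDiffOn.absolutelyContinuousOnInterval

lemma continuous_of_absolutelyContinuousOnInterval {n : ℕ} {x : ℝ → Fin n → ℝ}
    (h : ∀ a b, AbsolutelyContinuousOnInterval x a b) : Continuous x := by
  refine continuous_iff_continuousAt.2 fun t => ?_
  refine (h (t - 1) (t + 1)).continuousOn.continuousAt ?_
  rw [Set.uIcc_of_le (by linarith)]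
  exact Icc_mem_nhds (by linarith) (by linarith)

lemma continuous_mulVec {m n : ℕ} (A : Matrix (Fin m) (Fin n) ℝ) :
    Continuous fun v : Fin n → ℝ => A.mulVec v :=
  A.mulVecLin.continuous_of_finiteDimensional

lemma hasDerivAt_mulVec {m n : ℕ} (L : Matrix (Fin m) (Fin n) ℝ) {x : ℝ → Fin n → ℝ}
    {x' : Fin n → ℝ} {t : ℝ} (h : HasDerivAt x x' t) :
    HasDerivAt (fun t => L.mulVec (x t)) (L.mulVec x') t :=
  ((LinearMap.toContinuousLinearMap L.mulVecLin).hasFDerivAt).comp_hasDerivAt t h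

/-- A Carathéodory solution of a linear differential equation is a classical solution. -/
lemma hasDerivAt_of_ae_hasDerivAt {n : ℕ} (A : Matrix (Fin n) (Fin n) ℝ) {x : ℝ → Fin n → ℝ}
    (hac : ∀ a b, AbsolutelyContinuousOnInterval x a b)
    (hx : ∀ᵐ t, HasDerivAt x (A.mulVec (x t)) t) (t : ℝ) :
    HasDerivAt x (A.mulVec (x t)) t := by
  have hc : Continuous fun s => A.mulVec (x s) :=
    (continuous_mulVec A).comp (continuous_of_absolutelyContinuousOnInterval hac)
  -- The primitive of the continuous function `A x` differs from `x` by an absolutely continuous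
  -- function with derivative zero almost everywhere, hence by a constant.
  have hG : ∀ s, HasDerivAt (fun s => ∫ τ in (0 : ℝ)..s, A.mulVec (x τ)) (A.mulVec (x s)) s :=
    fun s => (hc.integral_hasStrictDerivAt 0 s).hasDerivAt
  obtain ⟨c, hcst⟩ := ((hac (t - 1) (t + 1)).sub
    (absolutelyContinuousOnInterval_of_hasDerivAt hG hc (t - 1) (t + 1))).const_of_ae_hasDerivAt_zero
    (by
      filter_upwards [hx] with s hs _
      simpa using hs.sub (hG s))
  refine ((hG t).const_add c).congr_of_eventuallyEq ?_
  have hmem : Set.uIcc (t - 1) (t + 1) ∈ 𝓝 t := by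
    rw [Set.uIcc_of_le (by linarith)]
    exact Icc_mem_nhds (by linarith) (by linarith)
  filter_upwards [hmem] with s hs
  exact sub_eq_iff_eq_add.1 (hcst s hs)

lemma isSolution_of_hasDerivAt {n m p r : ℕ}
    (A : Matrix (Fin n) (Fin n) ℝ) (B : Matrix (Fin n) (Fin m) ℝ)
    (C : Matrix (Fin p) (Fin n) ℝ) (D : Matrix (Fin p) (Fin m) ℝ)
    (K : Matrix (Fin r) (Fin n) ℝ) {x : ℝ → Fin n → ℝ}
    (hx : ∀ t, HasDerivAt x (A.mulVec (x t)) t) (hC : ∀ t, C.mulVec (x t) = 0) :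
    IsSolution A B C D K x 0 0 (fun t => K.mulVec (x t)) := by
  have hc : Continuous x := continuous_iff_continuousAt.2 fun t => (hx t).continuousAt
  exact
    { locallyIntegrable_x := hc.locallyIntegrable
      locallyIntegrable_u := locallyIntegrable_zero
      locallyIntegrable_y := locallyIntegrable_zero
      locallyIntegrable_z := ((continuous_mulVec K).comp hc).locallyIntegrable
      absolutelyContinuous :=
        absolutelyContinuousOnInterval_of_hasDerivAt hx ((continuous_mulVec A).comp hc)
      state_eq := by simpa using Eventually.of_forall hx
      output_eq := by simp [hC]
      functional_eq := by simp }

lemma IsSolution.sub_hasDerivAt {n m p r : ℕ}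
    {A : Matrix (Fin n) (Fin n) ℝ} {B : Matrix (Fin n) (Fin m) ℝ}
    {C : Matrix (Fin p) (Fin n) ℝ} {D : Matrix (Fin p) (Fin m) ℝ}
    {K : Matrix (Fin r) (Fin n) ℝ} {x₁ x₂ : ℝ → Fin n → ℝ} {u : ℝ → Fin m → ℝ}
    {y : ℝ → Fin p → ℝ} {z₁ z₂ : ℝ → Fin r → ℝ}
    (h₁ : IsSolution A B C D K x₁ u y z₁) (h₂ : IsSolution A B C D K x₂ u y z₂) (t : ℝ) :
    HasDerivAt (x₁ - x₂) (A.mulVec ((x₁ - x₂) t)) t := by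
  refine hasDerivAt_of_ae_hasDerivAt A
    (fun a b => (h₁.absolutelyContinuous a b).sub (h₂.absolutelyContinuous a b)) ?_ t
  filter_upwards [h₁.state_eq, h₂.state_eq] with s hs₁ hs₂
  refine (hs₁.sub hs₂).congr_deriv ?_
  rw [Pi.sub_apply, Matrix.mulVec_sub]
  abel

/-- Continuity upgrades the almost-everywhere output equation to every time. -/
lemma IsSolution.mulVec_sub_eq_zero {n m p r : ℕ}
    {A : Matrix (Fin n) (Fin n) ℝ} {B : Matrix (Fin n) (Fin m) ℝ}
    {C : Matrix (Fin p) (Fin n) ℝ} {D : Matrix (Fin p) (Fin m) ℝ}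
    {K : Matrix (Fin r) (Fin n) ℝ} {x₁ x₂ : ℝ → Fin n → ℝ} {u : ℝ → Fin m → ℝ}
    {y : ℝ → Fin p → ℝ} {z₁ z₂ : ℝ → Fin r → ℝ}
    (h₁ : IsSolution A B C D K x₁ u y z₁) (h₂ : IsSolution A B C D K x₂ u y z₂) (t : ℝ) :
    C.mulVec ((x₁ - x₂) t) = 0 := by
  have hc : Continuous fun t => C.mulVec ((x₁ - x₂) t) := (continuous_mulVec C).comp
    ((continuous_of_absolutelyContinuousOnInterval h₁.absolutelyContinuous).sub
      (continuous_of_absolutelyContinuousOnInterval h₂.absolutelyContinuous))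
  have hae : (fun t => C.mulVec ((x₁ - x₂) t)) =ᵐ[volume] fun _ => 0 := by
    filter_upwards [h₁.output_eq, h₂.output_eq] with s hs₁ hs₂
    rw [Pi.sub_apply, Matrix.mulVec_sub, sub_eq_zero]
    exact add_right_cancel (hs₁.symm.trans hs₂)
  exact congrFun ((hc.ae_eq_iff_eq volume continuous_const).1 hae) t

lemma essTendstoZero_of_tendsto {r : ℕ} {z f : ℝ → Fin r → ℝ} (hf : Tendsto f atTop (𝓝 0))
    (hz : ∀ᵐ t, z t = f t) : EssTendstoZero z := by
  have hf' : Tendsto (fun t => ‖WithLp.toLp 2 (f t)‖ₑ) atTop (𝓝 0) := by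
    have hc : Continuous fun v : Fin r → ℝ => ‖WithLp.toLp 2 v‖ₑ :=
      (PiLp.continuous_toLp 2 _).enorm
    have h := (hc.tendsto 0).comp hf
    rwa [WithLp.toLp_zero, enorm_zero] at h
  refine ENNReal.tendsto_nhds_zero.2 fun ε hε => ?_
  obtain ⟨T, hT⟩ := eventually_atTop.1 (ENNReal.tendsto_nhds_zero.1 hf' ε hε)
  filter_upwards [eventually_ge_atTop T] with t ht
  refine essSup_le_of_ae_le ε ?_
  rw [EventuallyLE, ae_restrict_iff' measurableSet_Ici]
  filter_upwards [hz] with s hs hts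
  rw [hs]
  exact hT s (ht.trans hts)

lemma EssTendstoZero.exists_ae_abs_lt {r : ℕ} {z : ℝ → Fin r → ℝ} (hz : EssTendstoZero z)
    {ε : ℝ} (hε : 0 < ε) : ∃ T : ℝ, ∀ᵐ t, T ≤ t → ∀ i, |z t i| < ε := by
  obtain ⟨T, hT⟩ := (hz.eventually (gt_mem_nhds (ENNReal.ofReal_pos.2 hε))).exists
  refine ⟨T, ?_⟩
  have h := ae_lt_of_essSup_lt hT
  rw [ae_restrict_iff' measurableSet_Ici] at h
  filter_upwards [h] with s hs hTs i
  have h1 := hs hTs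
  rw [← ofReal_norm, ENNReal.ofReal_lt_ofReal_iff hε] at h1
  exact (PiLp.norm_apply_le (WithLp.toLp 2 (z s)) i).trans_lt h1

/-- Differentiating `C A ^ i w = 0` along the flow gives `C A ^ (i + 1) w = 0`. -/
lemma eq_zero_of_hasDerivAt_of_observable {n p : ℕ} {A : Matrix (Fin n) (Fin n) ℝ}
    {C : Matrix (Fin p) (Fin n) ℝ} (h : Observable A C) {w : ℝ → Fin n → ℝ}
    (hw : ∀ t, HasDerivAt w (A.mulVec (w t)) t) (hC : ∀ t, C.mulVec (w t) = 0) (t : ℝ) :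
    w t = 0 := by
  have key : ∀ i : ℕ, ∀ t, (C * A ^ i).mulVec (w t) = 0 := by
    intro i
    induction i with
    | zero => simpa using hC
    | succ i ih =>
      intro t
      have h1 := hasDerivAt_mulVec (C * A ^ i) (hw t)
      simp only [ih, Matrix.mulVec_mulVec, Matrix.mul_assoc, ← pow_succ] at h1
      exact h1.unique (hasDerivAt_const t 0)
  exact eq_zero_of_observable h fun i _ => key i t

/-! ### The block coordinates -/

/-- The block rows of `Pᵀ` and the last block column of `P`, with the relations that the
decomposition imposes on them. -/
structure BlockCoordinates {n p r n₁ n₂ n₃ : ℕ} (A : Matrix (Fin n) (Fin n) ℝ)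
    (C : Matrix (Fin p) (Fin n) ℝ) (K : Matrix (Fin r) (Fin n) ℝ)
    (A₁ : Matrix (Fin n₁) (Fin n₁) ℝ) (A₂₁ : Matrix (Fin n₂) (Fin n₁) ℝ)
    (A₂ : Matrix (Fin n₂) (Fin n₂) ℝ) (A₃ : Matrix (Fin n₃) (Fin n₃) ℝ)
    (C₁ : Matrix (Fin p) (Fin n₁) ℝ) (K₁ : Matrix (Fin r) (Fin n₁) ℝ)
    (K₂ : Matrix (Fin r) (Fin n₂) ℝ) (K₃ : Matrix (Fin r) (Fin n₃) ℝ)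
    (L₁ : Matrix (Fin n₁) (Fin n) ℝ) (L₂ : Matrix (Fin n₂) (Fin n) ℝ)
    (L₃ : Matrix (Fin n₃) (Fin n) ℝ) (E₃ : Matrix (Fin n) (Fin n₃) ℝ) : Prop where
  L₁_mul : L₁ * A = A₁ * L₁
  L₂_mul : L₂ * A = A₂₁ * L₁ + A₂ * L₂
  mul_E₃ : A * E₃ = E₃ * A₃
  C_eq : C = C₁ * L₁
  K_eq : K = K₁ * L₁ + K₂ * L₂ + K₃ * L₃
  C_mul_E₃ : C * E₃ = 0
  K_mul_E₃ : K * E₃ = K₃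

/-- Since `P Pᵀ = 1`, the block form `M` of `Pᵀ A P` gives `Pᵀ A = M Pᵀ` and `A P = P M`; the
relations are block rows of the first and the last block column of the second. -/
lemma Decomposition.exists_blockCoordinates {n m p r n₁ n₂ n₃ : ℕ}
    {A : Matrix (Fin n) (Fin n) ℝ} {B : Matrix (Fin n) (Fin m) ℝ}
    {C : Matrix (Fin p) (Fin n) ℝ} {K : Matrix (Fin r) (Fin n) ℝ}
    {P : Matrix (Fin n) (Fin n) ℝ} (dec : Decomposition A B C K P n₁ n₂ n₃) :
    ∃ L₁ L₂ L₃ E₃, BlockCoordinates A C K dec.A₁ dec.A₂₁ dec.A₂ dec.A₃ dec.C₁ dec.K₁ dec.K₂ dec.K₃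
      L₁ L₂ L₃ E₃ := by
  set e := blockEquiv dec.dim_eq
  have hPP : P * P.transpose = 1 := (Matrix.mem_orthogonalGroup_iff (Fin n) ℝ).1 dec.orthogonal
  have hA : P.transpose.submatrix e id * A =
      Matrix.fromBlocks (Matrix.fromBlocks dec.A₁ 0 dec.A₂₁ dec.A₂) 0
        (Matrix.fromCols dec.A₃₁ dec.A₃₂) dec.A₃ * P.transpose.submatrix e id := by
    rw [← dec.A_eq, Matrix.submatrix_mul_equiv, Matrix.mul_assoc, hPP, Matrix.mul_one]
    exact Matrix.submatrix_mul_equiv P.transpose A e (Equiv.refl _) id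
  have hA' : A * P.submatrix id e = P.submatrix id e *
      Matrix.fromBlocks (Matrix.fromBlocks dec.A₁ 0 dec.A₂₁ dec.A₂) 0
        (Matrix.fromCols dec.A₃₁ dec.A₃₂) dec.A₃ := by
    rw [← dec.A_eq, Matrix.submatrix_mul_equiv, ← Matrix.mul_assoc, ← Matrix.mul_assoc, hPP,
      Matrix.one_mul]
    exact Matrix.submatrix_mul_equiv A P id (Equiv.refl _) e
  have hC := dec.C_eq
  have hC' : C = Matrix.fromCols (Matrix.fromCols dec.C₁ (0 : Matrix (Fin p) (Fin n₂) ℝ))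
      (0 : Matrix (Fin p) (Fin n₃) ℝ) * P.transpose.submatrix e id := by
    rw [← dec.C_eq, Matrix.submatrix_mul_equiv, Matrix.mul_assoc, hPP, Matrix.mul_one]
    rfl
  have hK := dec.K_eq
  have hK' : K = Matrix.fromCols (Matrix.fromCols dec.K₁ dec.K₂) dec.K₃ *
      P.transpose.submatrix e id := by
    rw [← dec.K_eq, Matrix.submatrix_mul_equiv, Matrix.mul_assoc, hPP, Matrix.mul_one]
    rfl
  refine ⟨P.transpose.submatrix (fun i => e (Sum.inl (Sum.inl i))) id,
    P.transpose.submatrix (fun i => e (Sum.inl (Sum.inr i))) id,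
    P.transpose.submatrix (fun i => e (Sum.inr i)) id,
    P.submatrix id (fun i => e (Sum.inr i)), ?_, ?_, ?_, ?_, ?_, ?_, ?_⟩
  · ext i j
    simpa [Matrix.mul_apply, Fintype.sum_sum_type] using
      congrFun (congrFun hA (Sum.inl (Sum.inl i))) j
  · ext i j
    simpa [Matrix.mul_apply, Fintype.sum_sum_type] using
      congrFun (congrFun hA (Sum.inl (Sum.inr i))) j
  · ext i j
    simpa [Matrix.mul_apply, Fintype.sum_sum_type] using
      congrFun (congrFun hA' i) (Sum.inr j)
  · ext i j
    simpa [Matrix.mul_apply, Fintype.sum_sum_type] using congrFun (congrFun hC' i) j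
  · ext i j
    simpa [Matrix.mul_apply, Fintype.sum_sum_type] using congrFun (congrFun hK' i) j
  · ext i j
    simpa [Matrix.mul_apply, Fintype.sum_sum_type] using congrFun (congrFun hC i) (Sum.inr j)
  · ext i j
    simpa [Matrix.mul_apply, Fintype.sum_sum_type] using congrFun (congrFun hK i) (Sum.inr j)

/-! ### Complexification and the kernel of `detMatrix` -/

lemma map_ofReal_mul {l m n : ℕ} (M : Matrix (Fin l) (Fin m) ℝ) (N : Matrix (Fin m) (Fin n) ℝ) :
    (M * N).map Complex.ofReal = M.map Complex.ofReal * N.map Complex.ofReal :=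
  Matrix.map_mul (f := Complex.ofRealHom)

lemma map_ofReal_add {m n : ℕ} (M N : Matrix (Fin m) (Fin n) ℝ) :
    (M + N).map Complex.ofReal = M.map Complex.ofReal + N.map Complex.ofReal :=
  Matrix.map_add _ Complex.ofReal_add M N

lemma eq_zero_of_map_ofReal_mulVec {m n : ℕ} {M : Matrix (Fin m) (Fin n) ℝ}
    (h : ∀ v, (M.map Complex.ofReal).mulVec v = 0) : M = 0 := by
  ext i j
  have := congrFun (h (Pi.single j 1)) i
  simpa using this

lemma detMatrix_mulVec_eq_zero_iff {n p : ℕ} (A : Matrix (Fin n) (Fin n) ℝ)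
    (C : Matrix (Fin p) (Fin n) ℝ) (k : ℕ) (μ : ℂ) (v : Fin n → ℂ) :
    (detMatrix A C k μ).mulVec v = 0 ↔
      (∀ i < k, (C.map Complex.ofReal * (μ • 1 - A.map Complex.ofReal) ^ i).mulVec v = 0) ∧
        ((μ • 1 - A.map Complex.ofReal) ^ k).mulVec v = 0 := by
  rw [detMatrix, Matrix.fromRows_mulVec]
  constructor
  · intro h
    refine ⟨fun i hi => ?_, ?_⟩
    · ext j
      exact congrFun h (Sum.inl (⟨i, hi⟩, j))
    · ext j
      exact congrFun h (Sum.inr j)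
  · rintro ⟨h1, h2⟩
    ext (⟨i, j⟩ | j)
    · exact congrFun (h1 i i.2) j
    · exact congrFun h2 j

lemma pow_smul_sub_mulVec_eq_zero_iff {n : ℕ} (M : Matrix (Fin n) (Fin n) ℂ) (μ : ℂ) (N : ℕ)
    (v : Fin n → ℂ) :
    ((μ • 1 - M) ^ N).mulVec v = 0 ↔ ((M - μ • 1) ^ N).mulVec v = 0 := by
  rw [← neg_sub M, neg_pow, ← Matrix.mulVec_mulVec]
  rcases neg_one_pow_eq_or (Matrix (Fin n) (Fin n) ℂ) N with h | h <;>
    simp [h, Matrix.neg_mulVec]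

lemma mul_pow_of_mul_eq {l n : ℕ} {L : Matrix (Fin l) (Fin n) ℂ} {M : Matrix (Fin n) (Fin n) ℂ}
    {N : Matrix (Fin l) (Fin l) ℂ} (h : L * M = N * L) (i : ℕ) : L * M ^ i = N ^ i * L := by
  induction i with
  | zero => simp
  | succ i ih => rw [pow_succ, ← Matrix.mul_assoc, ih, Matrix.mul_assoc, h, ← Matrix.mul_assoc,
      ← pow_succ]

/-- Powers of `A` and of `μ I - A` below a given order span the same space. -/
lemma mul_pow_mulVec_eq_zero_of_shift {n p : ℕ} (C : Matrix (Fin p) (Fin n) ℂ)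
    (A : Matrix (Fin n) (Fin n) ℂ) (μ : ℂ) {N : ℕ} {v : Fin n → ℂ}
    (h : ∀ i < N, (C * (μ • 1 - A) ^ i).mulVec v = 0) :
    ∀ i < N, (C * A ^ i).mulVec v = 0 := by
  intro i hi
  -- Binomial expansion of `A = -(μ - A) + μ`: only powers `j ≤ i < N` of `μ - A` occur.
  have hc : Commute (-(μ • 1 - A)) (μ • (1 : Matrix (Fin n) (Fin n) ℂ)) :=
    (Commute.one_right _).smul_right μ
  have h1 : A = -(μ • 1 - A) + μ • 1 := by abel
  rw [h1, hc.add_pow, Matrix.mul_sum, Matrix.sum_mulVec]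
  refine Finset.sum_eq_zero fun j hj => ?_
  have hj' : j < N := by have := Finset.mem_range.1 hj; omega
  have h2 : C * ((-(μ • 1 - A)) ^ j * (μ • 1) ^ (i - j) * (i.choose j : Matrix (Fin n) (Fin n) ℂ)) =
      ((-1) ^ j * μ ^ (i - j) * (i.choose j : ℂ)) • (C * (μ • 1 - A) ^ j) := by
    rw [show -(μ • 1 - A) = (-1 : ℂ) • (μ • 1 - A) by simp, smul_pow, smul_pow, one_pow,
      ← nsmul_one (i.choose j), ← Nat.cast_smul_eq_nsmul ℂ]
    simp only [Matrix.mul_smul, Matrix.mul_one, smul_smul]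
    congr 1
    ring
  rw [h2, Matrix.smul_mulVec, h j hj', smul_zero]

/-! ### The implications in block coordinates -/

section

variable {n m p r n₁ n₂ n₃ : ℕ} {A : Matrix (Fin n) (Fin n) ℝ}
    {C : Matrix (Fin p) (Fin n) ℝ} {K : Matrix (Fin r) (Fin n) ℝ}
    {A₁ : Matrix (Fin n₁) (Fin n₁) ℝ} {A₂₁ : Matrix (Fin n₂) (Fin n₁) ℝ}
    {A₂ : Matrix (Fin n₂) (Fin n₂) ℝ} {A₃ : Matrix (Fin n₃) (Fin n₃) ℝ}
    {C₁ : Matrix (Fin p) (Fin n₁) ℝ} {K₁ : Matrix (Fin r) (Fin n₁) ℝ}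
    {K₂ : Matrix (Fin r) (Fin n₂) ℝ} {K₃ : Matrix (Fin r) (Fin n₃) ℝ}
    {L₁ : Matrix (Fin n₁) (Fin n) ℝ} {L₂ : Matrix (Fin n₂) (Fin n) ℝ}
    {L₃ : Matrix (Fin n₃) (Fin n) ℝ} {E₃ : Matrix (Fin n) (Fin n₃) ℝ}

lemma BlockCoordinates.partiallyDetectable
    (hb : BlockCoordinates A C K A₁ A₂₁ A₂ A₃ C₁ K₁ K₂ K₃ L₁ L₂ L₃ E₃)
    (hobs : Observable A₁ C₁) (hst : ∀ μ ∈ complexSpectrum A₂, μ.re < 0) (hK : K₃ = 0)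
    (B : Matrix (Fin n) (Fin m) ℝ) (D : Matrix (Fin p) (Fin m) ℝ) :
    PartiallyDetectable A B C D K := by
  intro x₁ x₂ u y z₁ z₂ h₁ h₂
  have hx := h₁.sub_hasDerivAt h₂
  have hC := h₁.mulVec_sub_eq_zero h₂
  set x := x₁ - x₂ with hxdef
  have hw₁ : ∀ t, L₁.mulVec (x t) = 0 :=
    eq_zero_of_hasDerivAt_of_observable hobs (w := fun t => L₁.mulVec (x t))
      (fun t => (hasDerivAt_mulVec L₁ (hx t)).congr_deriv (by
        rw [Matrix.mulVec_mulVec, Matrix.mulVec_mulVec, hb.L₁_mul]))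
      (fun t => by rw [Matrix.mulVec_mulVec, ← hb.C_eq, hC t])
  have hw₂ : Tendsto (fun t => L₂.mulVec (x t)) atTop (𝓝 0) :=
    tendsto_zero_of_stable A₂ hst fun t => (hasDerivAt_mulVec L₂ (hx t)).congr_deriv (by
      rw [Matrix.mulVec_mulVec, hb.L₂_mul, Matrix.add_mulVec, ← Matrix.mulVec_mulVec, hw₁ t,
        Matrix.mulVec_zero, zero_add, Matrix.mulVec_mulVec])
  have hlim : Tendsto (fun t => K₂.mulVec (L₂.mulVec (x t))) atTop (𝓝 0) := by
    have h := ((continuous_mulVec K₂).tendsto 0).comp hw₂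
    rwa [Matrix.mulVec_zero] at h
  refine essTendstoZero_of_tendsto hlim ?_
  filter_upwards [h₁.functional_eq, h₂.functional_eq] with t ht₁ ht₂
  rw [ht₁, ht₂, ← Matrix.mulVec_sub, ← Pi.sub_apply, ← hxdef, hb.K_eq, hK, Matrix.zero_mul,
    add_zero, Matrix.add_mulVec, ← Matrix.mulVec_mulVec, ← Matrix.mulVec_mulVec, hw₁ t,
    Matrix.mulVec_zero, zero_add]

/-- Algebraic counterpart of the decay argument: observability kills `L₁ v`, after which `L₂ v` is a
generalized eigenvector of `A₂` at `μ`, impossible for `0 ≤ Re μ` unless it vanishes. -/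
lemma BlockCoordinates.mulVec_eq_zero_of_detMatrix
    (hb : BlockCoordinates A C K A₁ A₂₁ A₂ A₃ C₁ K₁ K₂ K₃ L₁ L₂ L₃ E₃) (hn : n₁ ≤ n)
    (hobs : Observable A₁ C₁) (hst : ∀ μ ∈ complexSpectrum A₂, μ.re < 0) (hK : K₃ = 0)
    {μ : ℂ} (hμ : 0 ≤ μ.re) {v : Fin n → ℂ} (hv : (detMatrix A C n μ).mulVec v = 0) :
    (K.map Complex.ofReal).mulVec v = 0 := by
  obtain ⟨hv₁, hv₂⟩ := (detMatrix_mulVec_eq_zero_iff A C n μ v).1 hv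
  have hL₁ : L₁.map Complex.ofReal * (μ • 1 - A.map Complex.ofReal) =
      (μ • 1 - A₁.map Complex.ofReal) * L₁.map Complex.ofReal := by
    rw [Matrix.mul_sub, Matrix.sub_mul, ← map_ofReal_mul, ← map_ofReal_mul, hb.L₁_mul]
    simp
  have hL₂ : L₂.map Complex.ofReal * (μ • 1 - A.map Complex.ofReal) =
      (μ • 1 - A₂.map Complex.ofReal) * L₂.map Complex.ofReal
        - A₂₁.map Complex.ofReal * L₁.map Complex.ofReal := by
    rw [Matrix.mul_sub, Matrix.sub_mul, ← map_ofReal_mul, ← map_ofReal_mul, ← map_ofReal_mul,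
      hb.L₂_mul, map_ofReal_add]
    simp only [Matrix.mul_smul, Matrix.smul_mul, Matrix.mul_one, Matrix.one_mul]
    abel
  have hw₁ : (L₁.map Complex.ofReal).mulVec v = 0 := by
    refine eq_zero_of_observable_complex hobs
      (mul_pow_mulVec_eq_zero_of_shift _ _ μ fun i hi => ?_)
    rw [Matrix.mulVec_mulVec, Matrix.mul_assoc, ← mul_pow_of_mul_eq hL₁, ← Matrix.mul_assoc,
      ← map_ofReal_mul, ← hb.C_eq]
    exact hv₁ i (hi.trans_le hn)
  have hw₂ : (L₂.map Complex.ofReal).mulVec v = 0 := by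
    -- `L₂` intertwines `μ - A` with `μ - A₂` up to a term through `L₁`, which dies on every `(μ -
    -- A) ^ i v` because `L₁ v = 0`.
    have key : ∀ i, (L₂.map Complex.ofReal * (μ • 1 - A.map Complex.ofReal) ^ i).mulVec v =
        ((μ • 1 - A₂.map Complex.ofReal) ^ i * L₂.map Complex.ofReal).mulVec v := by
      intro i
      induction i with
      | zero => simp
      | succ i ih =>
        have h1 : ((A₂₁.map Complex.ofReal * L₁.map Complex.ofReal) *
            (μ • 1 - A.map Complex.ofReal) ^ i).mulVec v = 0 := by
          rw [Matrix.mul_assoc, mul_pow_of_mul_eq hL₁, ← Matrix.mulVec_mulVec,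
            ← Matrix.mulVec_mulVec, hw₁, Matrix.mulVec_zero, Matrix.mulVec_zero]
        rw [pow_succ', ← Matrix.mul_assoc, hL₂, Matrix.sub_mul, Matrix.sub_mulVec, h1, sub_zero,
          Matrix.mul_assoc, ← Matrix.mulVec_mulVec, ih, Matrix.mulVec_mulVec, ← Matrix.mul_assoc,
          ← pow_succ']
    have hμ' : μ ∉ spectrum ℂ (A₂.map Complex.ofReal) := fun h => (hst μ h).not_ge hμ
    refine eq_zero_of_notMem_spectrum hμ' (N := n) ?_
    rw [← pow_smul_sub_mulVec_eq_zero_iff, Matrix.mulVec_mulVec, ← key, ← Matrix.mulVec_mulVec,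
      hv₂, Matrix.mulVec_zero]
  rw [hb.K_eq, hK, Matrix.zero_mul, add_zero, map_ofReal_add, map_ofReal_mul, map_ofReal_mul,
    Matrix.add_mulVec, ← Matrix.mulVec_mulVec, ← Matrix.mulVec_mulVec, hw₁, hw₂,
    Matrix.mulVec_zero, Matrix.mulVec_zero, add_zero]

/-- `E₃` carries generalized eigenvectors of `A₃` into the kernel of `detMatrix`, and `K E₃ = K₃`.
-/
lemma BlockCoordinates.K₃_eq_zero_of_detMatrix
    (hb : BlockCoordinates A C K A₁ A₂₁ A₂ A₃ C₁ K₁ K₂ K₃ L₁ L₂ L₃ E₃) (hn : n₃ ≤ n)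
    (hun : ∀ μ ∈ complexSpectrum A₃, 0 ≤ μ.re)
    (h : ∀ μ : ℂ, 0 ≤ μ.re → ∀ v, (detMatrix A C n μ).mulVec v = 0 →
      (K.map Complex.ofReal).mulVec v = 0) : K₃ = 0 := by
  refine eq_zero_of_map_ofReal_mulVec fun v => ?_
  refine generalized_eigenvector_induction (A₃.map Complex.ofReal)
    (p := fun v => (K₃.map Complex.ofReal).mulVec v = 0) (fun μ v hv => ?_) (Matrix.mulVec_zero _)
    (fun v w hv hw => by rw [Matrix.mulVec_add, hv, hw, add_zero]) v
  by_cases hμ : μ ∈ spectrum ℂ (A₃.map Complex.ofReal)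
  · rw [← hb.K_mul_E₃, map_ofReal_mul, ← Matrix.mulVec_mulVec]
    refine h μ (hun μ hμ) _ ((detMatrix_mulVec_eq_zero_iff A C n μ _).2 ?_)
    have hE : (μ • 1 - A₃.map Complex.ofReal).transpose * (E₃.map Complex.ofReal).transpose =
        (E₃.map Complex.ofReal).transpose * (μ • 1 - A.map Complex.ofReal).transpose := by
      rw [← Matrix.transpose_mul, ← Matrix.transpose_mul, Matrix.mul_sub, Matrix.sub_mul,
        ← map_ofReal_mul, ← map_ofReal_mul, hb.mul_E₃]
      simp
    have hE' : ∀ i, (μ • 1 - A.map Complex.ofReal) ^ i * E₃.map Complex.ofReal =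
        E₃.map Complex.ofReal * (μ • 1 - A₃.map Complex.ofReal) ^ i := fun i => by
      have h1 := congrArg Matrix.transpose (mul_pow_of_mul_eq hE.symm i)
      simpa only [Matrix.transpose_mul, Matrix.transpose_pow, Matrix.transpose_transpose] using h1
    refine ⟨fun i _ => ?_, ?_⟩
    · rw [Matrix.mulVec_mulVec, Matrix.mul_assoc, hE', ← Matrix.mul_assoc, ← map_ofReal_mul,
        hb.C_mul_E₃, Matrix.map_zero _ Complex.ofReal_zero, Matrix.zero_mul, Matrix.zero_mulVec]
    -- The exponent `n₃` already kills `v`; the surplus `n - n₃` is harmless.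
    · obtain ⟨k, rfl⟩ := Nat.exists_eq_add_of_le' hn
      rw [Matrix.mulVec_mulVec, hE', ← Matrix.mulVec_mulVec, pow_add, ← Matrix.mulVec_mulVec,
        (pow_smul_sub_mulVec_eq_zero_iff _ _ _ _).2 hv, Matrix.mulVec_zero, Matrix.mulVec_zero]
  · rw [eq_zero_of_notMem_spectrum hμ hv, Matrix.mulVec_zero]

lemma BlockCoordinates.K₃_eq_zero_of_partiallyDetectable
    (hb : BlockCoordinates A C K A₁ A₂₁ A₂ A₃ C₁ K₁ K₂ K₃ L₁ L₂ L₃ E₃)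
    (hun : ∀ μ ∈ complexSpectrum A₃, 0 ≤ μ.re)
    {B : Matrix (Fin n) (Fin m) ℝ} {D : Matrix (Fin p) (Fin m) ℝ}
    (h : PartiallyDetectable A B C D K) : K₃ = 0 := by
  have hreal : ∀ w : ℝ → Fin n₃ → ℝ, (∀ t, HasDerivAt w (A₃.mulVec (w t)) t) →
      EssTendstoZero fun t => K₃.mulVec (w t) := by
    intro w hw
    have h1 := isSolution_of_hasDerivAt A B C D K (x := fun t => E₃.mulVec (w t))
      (fun t => (hasDerivAt_mulVec E₃ (hw t)).congr_deriv (by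
        rw [Matrix.mulVec_mulVec, Matrix.mulVec_mulVec, hb.mul_E₃]))
      (fun t => by rw [Matrix.mulVec_mulVec, hb.C_mul_E₃, Matrix.zero_mulVec])
    have h2 := isSolution_of_hasDerivAt A B C D K (x := fun _ => 0)
      (fun t => by simpa using hasDerivAt_const t (0 : Fin n → ℝ)) (fun _ => Matrix.mulVec_zero _)
    have h3 := h _ _ _ _ _ _ h1 h2
    simpa only [Matrix.mulVec_zero, sub_zero, Matrix.mulVec_mulVec, hb.K_mul_E₃] using h3
  -- Induction on the order `N` removes the polynomial factors: the higher terms of the solution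
  -- involve generalized eigenvectors of smaller order, which `K₃` already kills.
  have key : ∀ (μ : ℂ), 0 ≤ μ.re → ∀ N v, ((A₃.map Complex.ofReal - μ • 1) ^ N).mulVec v = 0 →
      (K₃.map Complex.ofReal).mulVec v = 0 := by
    intro μ hμ N
    induction N with
    | zero =>
      intro v hv
      rw [pow_zero, Matrix.one_mulVec] at hv
      rw [hv, Matrix.mulVec_zero]
    | succ N ih =>
      intro v hv
      have hφ := hasDerivAt_genSolution _ μ (N + 1) v hv
      set φ := genSolution (A₃.map Complex.ofReal) μ (N + 1) v with hφdef
      have hKφ : ∀ t, (K₃.map Complex.ofReal).mulVec (φ t) =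
          Complex.exp (t * μ) • (K₃.map Complex.ofReal).mulVec v := by
        intro t
        rw [hφdef, genSolution, Finset.sum_range_succ', Matrix.mulVec_smul, Matrix.mulVec_add,
          Matrix.mulVec_sum, Finset.sum_eq_zero, zero_add]
        · simp
        · intro j _
          rw [Matrix.mulVec_smul, ih, smul_zero]
          rw [Matrix.mulVec_mulVec, ← pow_add, show N + (j + 1) = j + (N + 1) by omega, pow_add,
            ← Matrix.mulVec_mulVec, hv, Matrix.mulVec_zero]
      -- Detectability concerns real solutions, so it is applied to the real and imaginary parts of
      -- `φ`.
      have hre := hreal (fun t i => (φ t i).re) fun t => by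
        rw [← re_mulVec]
        exact hasDerivAt_pi.2 fun i =>
          Complex.reCLM.hasFDerivAt.comp_hasDerivAt t (hasDerivAt_pi.1 (hφ t) i)
      have him := hreal (fun t i => (φ t i).im) fun t => by
        rw [← im_mulVec]
        exact hasDerivAt_pi.2 fun i =>
          Complex.imCLM.hasFDerivAt.comp_hasDerivAt t (hasDerivAt_pi.1 (hφ t) i)
      simp only [← re_mulVec, ← im_mulVec, hKφ] at hre him
      ext i
      by_contra hne
      -- Half the norm for each part: the two bounds then add up to less than the norm of `K₃ v` at
      -- `i`, whereas multiplication by `exp(tμ)` cannot decrease it for `t ≥ 0`.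
      have hpos : 0 < ‖(K₃.map Complex.ofReal).mulVec v i‖ / 2 := half_pos (norm_pos_iff.2 hne)
      obtain ⟨T₁, hT₁⟩ := hre.exists_ae_abs_lt hpos
      obtain ⟨T₂, hT₂⟩ := him.exists_ae_abs_lt hpos
      have hlt : ∀ᵐ t : ℝ, ¬ max (max T₁ T₂) 0 ≤ t := by
        filter_upwards [hT₁, hT₂] with t h₁ h₂ ht
        have h₁' := h₁ ((le_max_left _ _).trans ((le_max_left _ _).trans ht)) i
        have h₂' := h₂ ((le_max_right _ _).trans ((le_max_left _ _).trans ht)) i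
        have h0 : 0 ≤ t := (le_max_right _ _).trans ht
        have h3 := Complex.norm_le_abs_re_add_abs_im
          ((Complex.exp (t * μ) • (K₃.map Complex.ofReal).mulVec v) i)
        have h4 : 1 ≤ ‖Complex.exp (t * μ)‖ := by
          rw [Complex.norm_exp, Real.one_le_exp_iff]
          simpa using mul_nonneg h0 hμ
        rw [Pi.smul_apply, smul_eq_mul] at h₁' h₂' h3
        rw [norm_mul] at h3
        nlinarith [norm_nonneg ((K₃.map Complex.ofReal).mulVec v i)]
      -- Almost every time would avoid a half-line, which has infinite measure.
      rw [ae_iff] at hlt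
      simp only [not_not] at hlt
      change volume (Set.Ici (max (max T₁ T₂) 0)) = 0 at hlt
      simp at hlt
  refine eq_zero_of_map_ofReal_mulVec fun v => ?_
  refine generalized_eigenvector_induction (A₃.map Complex.ofReal)
    (p := fun v => (K₃.map Complex.ofReal).mulVec v = 0) (fun μ v hv => ?_) (Matrix.mulVec_zero _)
    (fun v w hv hw => by rw [Matrix.mulVec_add, hv, hw, add_zero]) v
  by_cases hμ : μ ∈ spectrum ℂ (A₃.map Complex.ofReal)
  · exact key μ (hun μ hμ) n₃ v hv
  · rw [eq_zero_of_notMem_spectrum hμ hv, Matrix.mulVec_zero]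

end

end PartialDetect

theorem mainTheorem2 {n m p r : ℕ}
    (A : Matrix (Fin n) (Fin n) ℝ) (B : Matrix (Fin n) (Fin m) ℝ)
    (C : Matrix (Fin p) (Fin n) ℝ) (D : Matrix (Fin p) (Fin m) ℝ)
    (K : Matrix (Fin r) (Fin n) ℝ)
    (P : Matrix (Fin n) (Fin n) ℝ) (n₁ n₂ n₃ : ℕ)
    (dec : PartialDetect.Decomposition A B C K P n₁ n₂ n₃) :
    List.TFAE [
      PartialDetect.PartiallyDetectable A B C D K,
      ∀ μ : ℂ, 0 ≤ μ.re →
        (Matrix.fromRows (PartialDetect.detMatrix A C n μ) (K.map Complex.ofReal)).rank =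
          (PartialDetect.detMatrix A C n μ).rank,
      dec.K₃ = 0] := by
  obtain ⟨L₁, L₂, L₃, E₃, hb⟩ := dec.exists_blockCoordinates
  have hn := dec.dim_eq
  simp only [PartialDetect.rank_fromRows_eq_iff]
  tfae_have 1 → 3 := fun h => hb.K₃_eq_zero_of_partiallyDetectable dec.unstable h
  tfae_have 3 → 1 := fun h => hb.partiallyDetectable dec.observable dec.stable h B D
  tfae_have 2 → 3 := fun h => hb.K₃_eq_zero_of_detMatrix (by omega) dec.unstable h
  tfae_have 3 → 2 := fun h μ hμ v hv =>
    hb.mulVec_eq_zero_of_detMatrix (by omega) dec.observable dec.stable h hμ hv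
  tfae_finish
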